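/- **Model.** A persuasion instance consists of finite sets $\Theta$ (states), $T$ (types), $A$ (actions), a prior $\mu\in\Delta(\Theta)$, a type distribution $\rho\in\Delta(T)$ (state and type are independent), the principal's payoff $v(\theta,a)$ and the payoff $u_t(\theta,a)$ of an agent of type $t$. A *partial-information-elicitation (PIE) mechanism* is a finite tree whose inner nodes are * signaling nodes: the principal, who knows the state $\theta$, sends one of finitely many signals $g$ with probability $\pi(g\mid\theta)$, and the play moves to the child belonging to $g$; * binding (partial) elicitation nodes: with $T_x\subseteq T$ the set of types not excluded so far ($T_x=T$ at the root), the principal offers finitely many nonempty sets of types whose union is $T_x$, the agent chooses one of them, and the chosen set becomes the set of types not excluded; * non-binding elicitation nodes: the agent chooses one of the children. At a leaf $x$ the (credible) agent chooses a type $t\in T_x$ to imitate, and an action that is optimal for $t$ under the posterior of $\theta$ at $x$ is played. The agent, whose true type $t$ may differ from the imitated one, uses a strategy that maximizes his expected payoff with respect to $u_t$. All ties (among the optimal actions of the imitated type, and among the agent's best strategies) are broken by the mechanism, possibly at random. A PIE mechanism is *optimal* if no PIE mechanism for the same instance gives the principal a higher expected payoff. Its *depth* is the largest number of inner nodes on a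 path from the root to a leaf. **Instances.** For $n\ge 1$ let $M=2n^{3^n}$, $\Theta=\{\theta_1,\dots,\theta_n\}$, $T=\{t_0,\dots,t_n\}$, $A=\{a_1,\dots,a_n,a'_1,\dots,a'_n\}$, let $\mu$ be uniform, $\rho(t_0)=1$, and let $v(\theta_j,a'_j)=1$ for all $j$ and $v=0$ otherwise. The agent's payoffs are, for $0\le i\le n$ and $1\le j,k\le n$, $$u_{t_i}(\theta_k,a_j)=\begin{cases}1&k=j>i\\0&\text{otherwise,}\end{cases}\qquad u_{t_i}(\theta_k,a'_j)=\begin{cases}-M&k\ne j,\ \text{or } k=j<i\\ 1/M&k=j=i\\ 1&k=j=n>i\\ 0&k=j,\ i<j<n.\end{cases}$$ **Theorem.** In this family of instances (with $n$ states and $n+1$ types) every optimal PIE mechanism has depth $\Omega(n)$: there are $c>0$ and $N$ such that for every $n\ge N$ (and $n \ge 1$) an optimal PIE mechanism exists, and every optimal PIE mechanism has depth at least $cn$. -/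

import Mathlib

noncomputable section

namespace Persuasion

/-- An instance of Bayesian persuasion with a privately typed agent. The state and the type are
drawn independently. -/
structure Instance (Θ T A : Type) [Fintype Θ] [Fintype T] where
  /-- distribution `μ` of the state -/
  prior : Θ → ℝ
  prior_mem : prior ∈ stdSimplex ℝ Θ
  /-- distribution `ρ` of the agent's type -/
  typeDist : T → ℝ
  typeDist_mem : typeDist ∈ stdSimplex ℝ T
  /-- the principal's payoff `v(θ, a)` -/
  v : Θ → A → ℝ
  /-- the payoff `u_t(θ, a)` of an agent of type `t` -/
  u : T → Θ → A → ℝ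

/-- The tree of a mechanism with partial information elicitation.
* `leaf act`: the mechanism terminates. The agent behaves like some type `t` that his answers have
  not excluded, and `act t` is the (possibly random) action that is then played. It has to be optimal
  for `t`, see `Tree.IsValid`; thus `act` only breaks ties among the optimal actions of `t`.
* `signal k π child`: a signaling step with `k` signals; in state `θ`, signal `g` is sent with
  probability `π θ g`.
* `elicit k opt child`: a binding elicitation step; the agent picks one of the sets `opt j` of types.
* `ask k child`: a non-binding elicitation step; the agent picks one of `k` branches. -/
inductive Tree (Θ T A : Type) : Type
  | leaf (act : T → A → ℝ) : Tree Θ T A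
  | signal (k : ℕ) (π : Θ → Fin k → ℝ) (child : Fin k → Tree Θ T A) : Tree Θ T A
  | elicit (k : ℕ) (opt : Fin k → Set T) (child : Fin k → Tree Θ T A) : Tree Θ T A
  | ask (k : ℕ) (child : Fin k → Tree Θ T A) : Tree Θ T A

namespace Tree

variable {Θ T A : Type}

/-- The depth of a mechanism: the largest number of steps on a path from the root to a leaf. -/
def depth : Tree Θ T A → ℕ
  | leaf _ => 0
  | signal _ _ child => (Finset.univ.sup fun g => (child g).depth) + 1
  | elicit _ _ child => (Finset.univ.sup fun j => (child j).depth) + 1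
  | ask _ child => (Finset.univ.sup fun j => (child j).depth) + 1

/-- `a` is an optimal action of type `t` if the state has (unnormalized) weights `w`, i.e. if the
posterior is proportional to `w`. -/
def IsOptimalAction [Fintype Θ] (u : T → Θ → A → ℝ) (w : Θ → ℝ) (t : T) (a : A) : Prop :=
  ∀ b : A, ∑ θ, w θ * u t θ b ≤ ∑ θ, w θ * u t θ a

/-- Well-formedness of the subtree at a node where `w θ` is the joint probability of the state `θ`
and of the signals sent on the way to the node, and `S` is the set of the types that are not excluded
by the agent's binding answers on the way to the node. -/
def IsValid [Fintype Θ] [Fintype A] (u : T → Θ → A → ℝ) :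
    Tree Θ T A → (Θ → ℝ) → Set T → Prop
  | leaf act, w, S => ∀ t ∈ S, act t ∈ stdSimplex ℝ A ∧
      ∀ a, act t a ≠ 0 → IsOptimalAction u w t a
  | signal k π child, w, S => (∀ θ, π θ ∈ stdSimplex ℝ (Fin k)) ∧
      ∀ g, (child g).IsValid u (fun θ => w θ * π θ g) S
  | elicit _ opt child, w, S => (⋃ j, opt j) = S ∧ (∀ j, (opt j).Nonempty) ∧
      ∀ j, (child j).IsValid u w (opt j)
  | ask k child, w, S => 0 < k ∧ ∀ j, (child j).IsValid u w S

/-- Behavior strategies of an agent: at a leaf, a distribution over the types to behave like; at an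
elicitation node, a distribution over the answers. -/
def Strategy : Tree Θ T A → Type
  | leaf _ => T → ℝ
  | signal k _ child => (g : Fin k) → (child g).Strategy
  | elicit k _ child => (Fin k → ℝ) × ((j : Fin k) → (child j).Strategy)
  | ask k child => (Fin k → ℝ) × ((j : Fin k) → (child j).Strategy)

/-- The strategies that consist of probability distributions and are credible: at a leaf, the agent
behaves like a type that is consistent with all his binding answers. Here `S` is the set of the types
that have not been excluded so far. -/
def IsFeasible [Fintype T] : (m : Tree Θ T A) → Set T → m.Strategy → Prop
  | leaf _, S, (σ : T → ℝ) => σ ∈ stdSimplex ℝ T ∧ ∀ t, σ t ≠ 0 → t ∈ S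
  | signal _ _ child, S, σ => ∀ g, (child g).IsFeasible S (σ g)
  | elicit k opt child, _, σ => σ.1 ∈ stdSimplex ℝ (Fin k) ∧
      ∀ j, (child j).IsFeasible (opt j) (σ.2 j)
  | ask k child, S, σ => σ.1 ∈ stdSimplex ℝ (Fin k) ∧ ∀ j, (child j).IsFeasible S (σ.2 j)

/-- Expectation of `f(θ, a)`, where `a` is the action that is finally played, if the agent uses the
strategy `σ` and the state has weights `w` at the root. -/
def expectation [Fintype Θ] [Fintype T] [Fintype A] (f : Θ → A → ℝ) :
    (m : Tree Θ T A) → m.Strategy → (Θ → ℝ) → ℝ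
  | leaf act, (σ : T → ℝ), w => ∑ t, σ t * ∑ a, act t a * ∑ θ, w θ * f θ a
  | signal _ π child, σ, w => ∑ g, (child g).expectation f (σ g) (fun θ => w θ * π θ g)
  | elicit _ _ child, σ, w => ∑ j, σ.1 j * (child j).expectation f (σ.2 j) w
  | ask _ child, σ, w => ∑ j, σ.1 j * (child j).expectation f (σ.2 j) w

/-- `σ` is a best response to the mechanism `m` of an agent whose true type is `t`: it maximizes his
expected payoff among all credible strategies. -/
def IsBestResponse [Fintype Θ] [Fintype T] [Fintype A] (I : Instance Θ T A)
    (m : Tree Θ T A) (t : T) (σ : m.Strategy) : Prop :=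
  m.IsFeasible Set.univ σ ∧ ∀ σ' : m.Strategy, m.IsFeasible Set.univ σ' →
    m.expectation (I.u t) σ' I.prior ≤ m.expectation (I.u t) σ I.prior

end Tree

/-- A mechanism with partial information elicitation. Ties in the agent's decisions are broken by the
mechanism, so a best response of each type is part of it. -/
structure PIEMechanism {Θ T A : Type} [Fintype Θ] [Fintype T] [Fintype A]
    (I : Instance Θ T A) where
  tree : Tree Θ T A
  valid : tree.IsValid I.u I.prior Set.univ
  response : T → tree.Strategy
  isBestResponse : ∀ t, tree.IsBestResponse I t (response t)

namespace PIEMechanism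

variable {Θ T A : Type} [Fintype Θ] [Fintype T] [Fintype A] {I : Instance Θ T A}

/-- The principal's expected payoff. -/
def payoff (P : PIEMechanism I) : ℝ :=
  ∑ t, I.typeDist t * P.tree.expectation I.v (P.response t) I.prior

/-- The depth of the tree of the mechanism. -/
def depth (P : PIEMechanism I) : ℕ := P.tree.depth

/-- The mechanism maximizes the principal's payoff among all mechanisms. -/
def IsOptimal (P : PIEMechanism I) : Prop :=
  ∀ P' : PIEMechanism I, P'.payoff ≤ P.payoff

end PIEMechanism

/-- The constant `M = 2 n^(3^n)`. -/
def bigM (n : ℕ) : ℝ := 2 * (n : ℝ) ^ (3 ^ n)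

/-- The agent's payoffs. The state `θ_j` (`1 ≤ j ≤ n`) is the element `j - 1` of `Fin n`, the type
`t_i` (`0 ≤ i ≤ n`) is the element `i` of `Fin (n + 1)`, and the actions `a_j` and `a'_j` are
`Sum.inl` and `Sum.inr` of the element `j - 1` of `Fin n`. -/
def chainPayoff (n : ℕ) (i : Fin (n + 1)) (θ : Fin n) : Fin n ⊕ Fin n → ℝ
  | Sum.inl j => if θ = j then (if (j : ℕ) + 1 ≤ (i : ℕ) then 0 else 1) else 0
  | Sum.inr j =>
      if θ = j then
        (if (j : ℕ) + 1 < (i : ℕ) then -bigM n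
         else if (j : ℕ) + 1 = (i : ℕ) then 1 / bigM n
         else if (j : ℕ) + 1 = n then 1
         else 0)
      else -bigM n

/-- The instance with `n` states, `n + 1` types and `2n` actions: the prior is uniform, only `t_0`
has positive probability, and the principal wants `a'_j` to be played in state `θ_j`. -/
def chainInstance (n : ℕ) (hn : 0 < n) :
    Instance (Fin n) (Fin (n + 1)) (Fin n ⊕ Fin n) where
  prior := fun _ => 1 / (n : ℝ)
  prior_mem := by
    refine ⟨fun _ => by positivity, ?_⟩
    have h : (n : ℝ) ≠ 0 := by positivity
    simp [h]
  typeDist := Pi.single 0 1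
  typeDist_mem := single_mem_stdSimplex ℝ 0
  v := fun θ a => if a = Sum.inr θ then 1 else 0
  u := chainPayoff n

end Persuasion

end

/-! Payoff 1 is an upper bound for the principal, and it is attained (`exists_payoff_eq_one`).
Optimality therefore means that `a'_j` is played in every state `θ_j`, and a tree achieving this
must be deep.

For attainment, the chain mechanism rules out one state at a time. Before each revelation the agent
may instead claim to be the smallest remaining type `t_i` and have `a_{i+1}` played, which is worth
`1/n` to `t_0`. Continuing is also worth `1/n`, all of it earned in `θ_n`, so the tie may be broken
in the principal's favour.

For the lower bound, full payoff passes to the branches that are reached (`Implements`). At a node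
with full payoff, `t_0` earns at most the weight of `θ_n`, yet imitating an admissible `t_i` earns
almost the weight of any `θ_k` with `k > i`. So no such weight exceeds that of `θ_n` by more than
the weight of `θ_i` over `M` (`weight_le_of_implements`). Weights start equal, and while `t_i` is
admissible signals can hardly separate the states after `θ_i` (`sum_deviation_signal_le`). A leaf
must nevertheless reveal the state, so small types have to be excluded; but excluding `t_i` and
`t_{i+1}` together while `θ_{i+1}` has weight loses payoff (`weight_eq_zero_of_implements`). Hence
useful elicitations advance the smallest type by one. The induction `weight_last_le` quantifies
this: a tree of depth below `n - 1` would force the prior weight of `θ_n` to be zero. -/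

namespace Persuasion

namespace Tree

/-! ### Linear bounds, imitation and inheritance of full payoff in arbitrary trees. -/

section General

variable {Θ T A : Type} [Fintype Θ] [Fintype T] [Fintype A]

theorem expectation_add (f g : Θ → A → ℝ) (m : Tree Θ T A) (σ : m.Strategy) (w : Θ → ℝ) :
    m.expectation (fun θ a => f θ a + g θ a) σ w = m.expectation f σ w + m.expectation g σ w := by
  induction m generalizing w with
  | leaf act =>
    simp only [expectation, mul_add, Finset.sum_add_distrib]
  | signal k π child ih =>
    simp only [expectation, ih, Finset.sum_add_distrib]
  | elicit k opt child ih =>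
    simp only [expectation, ih, mul_add, Finset.sum_add_distrib]
  | ask k child ih =>
    simp only [expectation, ih, mul_add, Finset.sum_add_distrib]

theorem sum_mul_le_of_mem_stdSimplex {ι : Type*} [Fintype ι] {p x : ι → ℝ} {c : ℝ}
    (hp : p ∈ stdSimplex ℝ ι) (hx : ∀ i, p i ≠ 0 → x i ≤ c) : ∑ i, p i * x i ≤ c := by
  calc ∑ i, p i * x i ≤ ∑ i, p i * c := by
        refine Finset.sum_le_sum fun i _ => ?_
        by_cases h : p i = 0
        · simp [h]
        · exact mul_le_mul_of_nonneg_left (hx i h) (hp.1 i)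
    _ = c := by rw [← Finset.sum_mul, hp.2, one_mul]

theorem le_sum_mul_of_mem_stdSimplex {ι : Type*} [Fintype ι] {p x : ι → ℝ} {c : ℝ}
    (hp : p ∈ stdSimplex ℝ ι) (hx : ∀ i, p i ≠ 0 → c ≤ x i) : c ≤ ∑ i, p i * x i := by
  have h := sum_mul_le_of_mem_stdSimplex (x := fun i => - x i) (c := -c) hp
    fun i hi => neg_le_neg (hx i hi)
  simp only [mul_neg, Finset.sum_neg_distrib] at h
  linarith

/-- Splitting the weights according to a signal does not change the value of a linear function. -/
theorem sum_signal {k : ℕ} {π : Θ → Fin k → ℝ} (hπ : ∀ θ, π θ ∈ stdSimplex ℝ (Fin k))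
    (w h : Θ → ℝ) : ∑ g, ∑ θ, w θ * π θ g * h θ = ∑ θ, w θ * h θ := by
  rw [Finset.sum_comm]
  refine Finset.sum_congr rfl fun θ _ => ?_
  rw [← Finset.sum_mul, ← Finset.mul_sum, (hπ θ).2, mul_one]

/-- If, at every leaf, every optimal action of every admissible type gives at most the linear function
`h` of the weights, then so does the whole tree. -/
theorem expectation_le (u : T → Θ → A → ℝ) (f : Θ → A → ℝ) (h : Θ → ℝ) (m : Tree Θ T A) (w : Θ → ℝ)
    (S : Set T) (σ : m.Strategy) (hw : ∀ θ, 0 ≤ w θ) (hm : m.IsValid u w S)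
    (hσ : m.IsFeasible S σ)
    (hf : ∀ w : Θ → ℝ, (∀ θ, 0 ≤ w θ) → ∀ t ∈ S, ∀ a, IsOptimalAction u w t a →
      ∑ θ, w θ * f θ a ≤ ∑ θ, w θ * h θ) :
    m.expectation f σ w ≤ ∑ θ, w θ * h θ := by
  induction m generalizing w S with
  | leaf act =>
    refine sum_mul_le_of_mem_stdSimplex hσ.1 fun t ht => ?_
    obtain ⟨h1, h2⟩ := hm t (hσ.2 t ht)
    exact sum_mul_le_of_mem_stdSimplex h1 fun a ha => hf w hw t (hσ.2 t ht) a (h2 a ha)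
  | signal k π child ih =>
    rw [← sum_signal hm.1 w h]
    exact Finset.sum_le_sum fun g _ =>
      ih g _ S (σ g) (fun θ => mul_nonneg (hw θ) ((hm.1 θ).1 g)) (hm.2 g) (hσ g) hf
  | elicit k opt child ih =>
    refine sum_mul_le_of_mem_stdSimplex hσ.1 fun j _ =>
      ih j w (opt j) (σ.2 j) hw (hm.2.2 j) (hσ.2 j) fun w hw t ht => hf w hw t ?_
    rw [← hm.1]
    exact Set.mem_iUnion_of_mem j ht
  | ask k child ih =>
    exact sum_mul_le_of_mem_stdSimplex hσ.1 fun j _ =>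
      ih j w S (σ.2 j) hw (hm.2 j) (hσ.2 j) hf

/-- The payoff of a pure choice is the payoff of the chosen branch. -/
theorem sum_single_mul {ι : Type*} [Fintype ι] [DecidableEq ι] (j : ι) (x : ι → ℝ) :
    ∑ i, (Pi.single j 1 : ι → ℝ) i * x i = x j := by
  simp [Pi.single_apply]

/-- Backward induction: some credible strategy maximizes the expectation of `f`. -/
theorem exists_isMaximal (u : T → Θ → A → ℝ) (f : Θ → A → ℝ) (m : Tree Θ T A) (w : Θ → ℝ)
    (S : Set T) (hS : S.Nonempty) (hm : m.IsValid u w S) :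
    ∃ σ : m.Strategy, m.IsFeasible S σ ∧
      ∀ σ' : m.Strategy, m.IsFeasible S σ' → m.expectation f σ' w ≤ m.expectation f σ w := by
  classical
  induction m generalizing w S with
  | leaf act =>
    obtain ⟨t, ht, hmax⟩ := Set.exists_max_image S
      (fun t => ∑ a, act t a * ∑ θ, w θ * f θ a) S.toFinite hS
    refine ⟨(Pi.single t 1 : T → ℝ), ⟨single_mem_stdSimplex ℝ t, fun s hs => ?_⟩, fun σ' hσ' => ?_⟩
    · by_cases h : s = t
      · exact h ▸ ht
      · exact absurd (Pi.single_eq_of_ne h _) hs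
    · simp only [expectation]
      rw [sum_single_mul]
      exact sum_mul_le_of_mem_stdSimplex hσ'.1 fun s hs => hmax s (hσ'.2 s hs)
  | signal k π child ih =>
    choose σ hσ hmax using fun g => ih g _ S hS (hm.2 g)
    exact ⟨σ, hσ, fun σ' hσ' => Finset.sum_le_sum fun g _ => hmax g (σ' g) (hσ' g)⟩
  | elicit k opt child ih =>
    choose σ hσ hmax using fun j => ih j w (opt j) (hm.2.1 j) (hm.2.2 j)
    obtain ⟨t, ht⟩ := hS
    rw [← hm.1] at ht
    obtain ⟨j₀, -⟩ := Set.mem_iUnion.1 ht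
    obtain ⟨j, -, hj⟩ := Finset.exists_max_image Finset.univ
      (fun j => (child j).expectation f (σ j) w) ⟨j₀, Finset.mem_univ _⟩
    refine ⟨((Pi.single j 1 : Fin k → ℝ), σ), ⟨single_mem_stdSimplex ℝ j, hσ⟩, fun σ' hσ' => ?_⟩
    simp only [expectation]
    rw [sum_single_mul]
    exact sum_mul_le_of_mem_stdSimplex hσ'.1 fun i _ =>
      (hmax i _ (hσ'.2 i)).trans (hj i (Finset.mem_univ _))
  | ask k child ih =>
    choose σ hσ hmax using fun j => ih j w S hS (hm.2 j)
    obtain ⟨j, -, hj⟩ := Finset.exists_max_image Finset.univ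
      (fun j => (child j).expectation f (σ j) w) ⟨⟨0, hm.1⟩, Finset.mem_univ _⟩
    refine ⟨((Pi.single j 1 : Fin k → ℝ), σ), ⟨single_mem_stdSimplex ℝ j, hσ⟩, fun σ' hσ' => ?_⟩
    simp only [expectation]
    rw [sum_single_mul]
    exact sum_mul_le_of_mem_stdSimplex hσ'.1 fun i _ =>
      (hmax i _ (hσ'.2 i)).trans (hj i (Finset.mem_univ _))

/-- By imitating the admissible type `t` throughout, the agent secures the linear function `h` of the
weights if every optimal action of `t` does. -/
theorem exists_imitation (u : T → Θ → A → ℝ) (f : Θ → A → ℝ) (h : Θ → ℝ) (t : T) (m : Tree Θ T A)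
    (w : Θ → ℝ) (S : Set T) (hw : ∀ θ, 0 ≤ w θ) (hm : m.IsValid u w S) (ht : t ∈ S)
    (hf : ∀ w : Θ → ℝ, (∀ θ, 0 ≤ w θ) → ∀ a, IsOptimalAction u w t a →
      ∑ θ, w θ * h θ ≤ ∑ θ, w θ * f θ a) :
    ∃ σ : m.Strategy, m.IsFeasible S σ ∧ ∑ θ, w θ * h θ ≤ m.expectation f σ w := by
  classical
  induction m generalizing w S with
  | leaf act =>
    refine ⟨(Pi.single t 1 : T → ℝ), ⟨single_mem_stdSimplex ℝ t, fun s hs => ?_⟩, ?_⟩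
    · by_cases h : s = t
      · exact h ▸ ht
      · exact absurd (Pi.single_eq_of_ne h _) hs
    · simp only [expectation]
      rw [sum_single_mul]
      exact le_sum_mul_of_mem_stdSimplex (hm t ht).1 fun a ha => hf w hw a ((hm t ht).2 a ha)
  | signal k π child ih =>
    choose σ hσ hle using fun g =>
      ih g _ S (fun θ => mul_nonneg (hw θ) ((hm.1 θ).1 g)) (hm.2 g) ht
    refine ⟨σ, hσ, ?_⟩
    rw [← sum_signal hm.1 w h]
    exact Finset.sum_le_sum fun g _ => hle g
  | elicit k opt child ih =>
    -- Maximality plays no role here: the branches not taken only need some credible strategy.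
    choose σ hσ _ using fun j =>
      exists_isMaximal u f (child j) w (opt j) (hm.2.1 j) (hm.2.2 j)
    have ht' := ht
    rw [← hm.1] at ht'
    obtain ⟨j, hj⟩ := Set.mem_iUnion.1 ht'
    obtain ⟨τ, hτ, hle⟩ := ih j w (opt j) hw (hm.2.2 j) hj
    refine ⟨((Pi.single j 1 : Fin k → ℝ), Function.update σ j τ),
      ⟨single_mem_stdSimplex ℝ j, fun i => ?_⟩, ?_⟩
    · by_cases h : i = j
      · subst h; simpa using hτ
      · simpa [Function.update_of_ne h] using hσ i
    · simp only [expectation]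
      rw [sum_single_mul]
      simpa using hle
  | ask k child ih =>
    choose σ hσ hle using fun j => ih j w S hw (hm.2 j) ht
    refine ⟨((Pi.single ⟨0, hm.1⟩ 1 : Fin k → ℝ), σ), ⟨single_mem_stdSimplex ℝ _, hσ⟩, ?_⟩
    simp only [expectation]
    rw [sum_single_mul]
    exact hle _

/-- Some strategy that is optimal for an agent with payoff `u₀` gives the principal, whose payoff `v`
is at most one, the largest conceivable payoff. -/
def Implements (u₀ v : Θ → A → ℝ) (m : Tree Θ T A) (w : Θ → ℝ) (S : Set T) : Prop :=
  ∃ σ : m.Strategy, m.IsFeasible S σ ∧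
    (∀ σ' : m.Strategy, m.IsFeasible S σ' → m.expectation u₀ σ' w ≤ m.expectation u₀ σ w) ∧
    m.expectation v σ w = ∑ θ, w θ

theorem expectation_le_sum (u : T → Θ → A → ℝ) (v : Θ → A → ℝ) (hv : ∀ θ a, v θ a ≤ 1)
    (m : Tree Θ T A) (w : Θ → ℝ) (S : Set T) (σ : m.Strategy) (hw : ∀ θ, 0 ≤ w θ)
    (hm : m.IsValid u w S) (hσ : m.IsFeasible S σ) : m.expectation v σ w ≤ ∑ θ, w θ := by
  have := expectation_le u v (fun _ => 1) m w S σ hw hm hσ fun w hw t _ a _ =>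
    Finset.sum_le_sum fun θ _ => mul_le_mul_of_nonneg_left (hv θ a) (hw θ)
  simpa using this

/-- A branch that is reached with positive probability inherits the property of the whole tree. -/
theorem implements_branch {u : T → Θ → A → ℝ} {u₀ v : Θ → A → ℝ}
    (hv : ∀ θ a, v θ a ≤ 1) {k : ℕ} {w : Fin k → Θ → ℝ} {opt : Fin k → Set T}
    {child : Fin k → Tree Θ T A} {p : Fin k → ℝ} {τ : (j : Fin k) → (child j).Strategy}
    (hw : ∀ j θ, 0 ≤ w j θ) (hm : ∀ j, (child j).IsValid u (w j) (opt j)) (hp : ∀ j, 0 ≤ p j)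
    (hτ : ∀ j, (child j).IsFeasible (opt j) (τ j))
    (hopt : ∀ τ' : (j : Fin k) → (child j).Strategy, (∀ j, (child j).IsFeasible (opt j) (τ' j)) →
      ∑ j, p j * (child j).expectation u₀ (τ' j) (w j) ≤
        ∑ j, p j * (child j).expectation u₀ (τ j) (w j))
    (hpay : ∑ j, p j * (child j).expectation v (τ j) (w j) = ∑ j, p j * ∑ θ, w j θ)
    (j : Fin k) (hj : p j ≠ 0) :
    (child j).Implements u₀ v (w j) (opt j) := by
  classical
  have hj0 : 0 < p j := lt_of_le_of_ne (hp j) (Ne.symm hj)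
  refine ⟨τ j, hτ j, fun τ' hτ' => ?_, ?_⟩
  -- A deviation inside branch `j` alone leaves the other summands unchanged, so they cancel.
  · have h1 := hopt (Function.update τ j τ') fun i => by
      by_cases h : i = j
      · subst h; simpa using hτ'
      · simpa [Function.update_of_ne h] using hτ i
    rw [← Finset.add_sum_erase _ _ (Finset.mem_univ j),
      ← Finset.add_sum_erase _ (fun i => p i * (child i).expectation u₀ (τ i) (w i))
        (Finset.mem_univ j)] at h1
    rw [Finset.sum_congr rfl (g := fun i => p i * (child i).expectation u₀ (τ i) (w i))
      (fun i hi => by rw [Function.update_of_ne (Finset.ne_of_mem_erase hi)])] at h1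
    simp only [Function.update_self, add_le_add_iff_right] at h1
    exact le_of_mul_le_mul_left h1 hj0
  · have hle : ∀ i ∈ Finset.univ,
        p i * (child i).expectation v (τ i) (w i) ≤ p i * ∑ θ, w i θ :=
      fun i _ => mul_le_mul_of_nonneg_left
        (expectation_le_sum u v hv _ _ _ _ (hw i) (hm i) (hτ i)) (hp i)
    have := (Finset.sum_eq_sum_iff_of_le hle).1 hpay j (Finset.mem_univ j)
    exact mul_left_cancel₀ hj this

/-- Signal probabilities sit in the unnormalized weights, so every branch has coefficient 1 and even
signals of probability zero are covered. -/
theorem Implements.signal {u : T → Θ → A → ℝ} {u₀ v : Θ → A → ℝ} (hv : ∀ θ a, v θ a ≤ 1) {k : ℕ}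
    {π : Θ → Fin k → ℝ} {child : Fin k → Tree Θ T A} {w : Θ → ℝ} {S : Set T} (hw : ∀ θ, 0 ≤ w θ)
    (hm : (Tree.signal k π child).IsValid u w S)
    (h : (Tree.signal k π child).Implements u₀ v w S) (g : Fin k) :
    (child g).Implements u₀ v (fun θ => w θ * π θ g) S := by
  obtain ⟨σ, hσ, hopt, hpay⟩ := h
  refine implements_branch (τ := σ) (p := fun _ => 1) (opt := fun _ => S)
    (w := fun g θ => w θ * π θ g) hv (fun g θ => mul_nonneg (hw θ) ((hm.1 θ).1 g)) hm.2
    (fun _ => zero_le_one) hσ (fun τ' hτ' => ?_) ?_ g one_ne_zero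
  · simp only [one_mul]
    exact hopt τ' hτ'
  · have := sum_signal hm.1 w fun _ => 1
    simp only [mul_one] at this
    simp only [one_mul, this]
    exact hpay

theorem exists_ne_zero_of_mem_stdSimplex {ι : Type*} [Fintype ι] {p : ι → ℝ}
    (hp : p ∈ stdSimplex ℝ ι) : ∃ i, p i ≠ 0 := by
  by_contra! h
  have := hp.2
  simp [h] at this

/-- Only answers given with positive probability inherit the property; at least one exists. -/
theorem Implements.elicit {u : T → Θ → A → ℝ} {u₀ v : Θ → A → ℝ} (hv : ∀ θ a, v θ a ≤ 1) {k : ℕ}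
    {opt : Fin k → Set T} {child : Fin k → Tree Θ T A} {w : Θ → ℝ} {S : Set T}
    (hw : ∀ θ, 0 ≤ w θ) (hm : (Tree.elicit k opt child).IsValid u w S)
    (h : (Tree.elicit k opt child).Implements u₀ v w S) :
    ∃ j, (child j).Implements u₀ v w (opt j) := by
  obtain ⟨σ, hσ, hopt, hpay⟩ := h
  obtain ⟨j, hj⟩ := exists_ne_zero_of_mem_stdSimplex hσ.1
  exact ⟨j, implements_branch (w := fun _ => w) hv (fun _ => hw) hm.2.2 hσ.1.1 hσ.2
    (fun τ' hτ' => hopt (σ.1, τ') ⟨hσ.1, hτ'⟩)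
    (by rw [← Finset.sum_mul, hσ.1.2, one_mul]; exact hpay) j hj⟩

theorem Implements.ask {u : T → Θ → A → ℝ} {u₀ v : Θ → A → ℝ} (hv : ∀ θ a, v θ a ≤ 1) {k : ℕ}
    {child : Fin k → Tree Θ T A} {w : Θ → ℝ} {S : Set T}
    (hw : ∀ θ, 0 ≤ w θ) (hm : (Tree.ask k child).IsValid u w S)
    (h : (Tree.ask k child).Implements u₀ v w S) :
    ∃ j, (child j).Implements u₀ v w S := by
  obtain ⟨σ, hσ, hopt, hpay⟩ := h
  obtain ⟨j, hj⟩ := exists_ne_zero_of_mem_stdSimplex hσ.1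
  exact ⟨j, implements_branch (w := fun _ => w) (opt := fun _ => S) hv (fun _ => hw) hm.2 hσ.1.1
    hσ.2 (fun τ' hτ' => hopt (σ.1, τ') ⟨hσ.1, hτ'⟩)
    (by rw [← Finset.sum_mul, hσ.1.2, one_mul]; exact hpay) j hj⟩

end General

end Tree

open Persuasion.Tree

/-! ### Constraints on the weights at a node with full payoff. -/

section Chain

variable {n : ℕ}

/-- The principal's payoff in `chainInstance`. -/
def chainReward (n : ℕ) (θ : Fin n) (a : Fin n ⊕ Fin n) : ℝ := if a = Sum.inr θ then 1 else 0

/-- The state `θ_n`. -/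
def lastState (hn : 0 < n) : Fin n := ⟨n - 1, Nat.sub_lt hn one_pos⟩

/-- The weight of the state `θ_i`, which is zero for `i = 0`. -/
def stateWeight (w : Fin n → ℝ) (i : ℕ) : ℝ := ∑ θ : Fin n, w θ * if (θ : ℕ) + 1 = i then 1 else 0

/-- The total deviation of the weights of the states `θ_{i+1}, …, θ_n` from the weight of `θ_n`. -/
def deviation (hn : 0 < n) (w : Fin n → ℝ) (i : ℕ) : ℝ :=
  ∑ θ ∈ Finset.univ.filter (fun θ : Fin n => i ≤ (θ : ℕ)), |w θ - w (lastState hn)|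

theorem two_le_bigM (hn : 0 < n) : 2 ≤ bigM n := by
  have h1 : (1 : ℝ) ≤ (n : ℝ) ^ (3 ^ n) := one_le_pow₀ (by exact_mod_cast hn)
  unfold bigM
  linarith

theorem chainReward_le_one (θ : Fin n) (a : Fin n ⊕ Fin n) : chainReward n θ a ≤ 1 := by
  unfold chainReward
  split_ifs <;> norm_num

/-- Only for `a'_i` in state `θ_i` can `t_i` value an action more than `t_0` does, and then by at
most `1 / M`. -/
theorem chainPayoff_le_zero_type (hn : 0 < n) (i : Fin (n + 1)) (θ : Fin n) (a : Fin n ⊕ Fin n) :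
    chainPayoff n i θ a ≤
      chainPayoff n 0 θ a + (if (θ : ℕ) + 1 = i then 1 else 0) / bigM n := by
  have hM := two_le_bigM hn
  have h0 : 0 < 1 / bigM n := by positivity
  rcases a with j | j
  · simp only [chainPayoff]
    split_ifs <;> simp_all <;> positivity
  · by_cases h : θ = j
    · subst h
      simp only [chainPayoff, if_true]
      split_ifs <;> simp_all <;> first | omega | linarith
    · simp only [chainPayoff, h, if_false]
      split_ifs <;> simp <;> linarith

/-- The interests of `t_0` and the principal are opposed except in `θ_n`: a rewarded action pays
`t_0` nothing in any other state. -/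
theorem chainPayoff_zero_add_reward (hn : 0 < n) (θ : Fin n) (a : Fin n ⊕ Fin n) :
    chainPayoff n 0 θ a + chainReward n θ a ≤ (if θ = lastState hn then 1 else 0) + 1 := by
  have hM := two_le_bigM hn
  rcases a with j | j
  · simp only [chainPayoff, chainReward]
    split_ifs <;> simp_all
  · by_cases h : θ = j
    · subst h
      simp only [chainPayoff, chainReward, lastState, Fin.ext_iff]
      split_ifs <;> simp_all <;> omega
    · simp only [chainPayoff, chainReward, h, if_false]
      split_ifs <;> simp_all <;> linarith

/-- If the principal gets the largest conceivable payoff, the agent's gain from imitating an admissible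
type `t_i` bounds the weights of the states `θ_k` with `k > i`. -/
theorem weight_le_of_implements (hn : 0 < n) {m : Tree (Fin n) (Fin (n + 1)) (Fin n ⊕ Fin n)}
    {w : Fin n → ℝ} {S : Set (Fin (n + 1))} (hw : ∀ θ, 0 ≤ w θ)
    (hm : m.IsValid (chainPayoff n) w S)
    (h : m.Implements (chainPayoff n 0) (chainReward n) w S) {i : Fin (n + 1)} (hi : i ∈ S)
    {k : Fin n} (hk : (i : ℕ) ≤ k) :
    w k - w (lastState hn) ≤ stateWeight w i / bigM n := by
  obtain ⟨σ, hσ, hopt, hpay⟩ := h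
  -- Combined with full payoff for the principal, this leaves `t_0` at most the weight of `θ_n`.
  have h1 := expectation_le (chainPayoff n)
    (fun θ a => chainPayoff n 0 θ a + chainReward n θ a)
    (fun θ => (if θ = lastState hn then 1 else 0) + 1) m w S σ hw hm hσ
    fun w hw t _ a _ => Finset.sum_le_sum fun θ _ =>
      mul_le_mul_of_nonneg_left (chainPayoff_zero_add_reward hn θ a) (hw θ)
  -- An optimal action of `t_i` is at least as good for `t_i` as `a_k`, which is worth the weight of
  -- its state; passing to the payoff of `t_0` costs at most the weight of `θ_i` over `M`.
  obtain ⟨τ, hτ, h2⟩ := exists_imitation (chainPayoff n) (chainPayoff n 0)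
    (fun θ => (if θ = k then 1 else 0) - (if (θ : ℕ) + 1 = i then 1 else 0) / bigM n) i m w S
    hw hm hi fun w hw a ha => by
      have h3 := ha (Sum.inl k)
      have h4 : ∀ θ, chainPayoff n i θ (Sum.inl k) = if θ = k then 1 else 0 := fun θ => by
        simp only [chainPayoff]
        rw [if_neg (show ¬ ((k : ℕ) + 1 ≤ i) by omega)]
      simp only [h4] at h3
      have h5 : ∑ θ, w θ * chainPayoff n i θ a ≤ ∑ θ, (w θ * chainPayoff n 0 θ a +
          w θ * ((if (θ : ℕ) + 1 = i then 1 else 0) / bigM n)) :=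
        Finset.sum_le_sum fun θ _ => by
          rw [← mul_add]
          exact mul_le_mul_of_nonneg_left (chainPayoff_le_zero_type hn i θ a) (hw θ)
      rw [Finset.sum_add_distrib] at h5
      simp only [mul_sub, Finset.sum_sub_distrib]
      linarith
  have h6 := hopt τ hτ
  rw [expectation_add, hpay] at h1
  have h7 : ∑ θ : Fin n, w θ * ((if (θ : ℕ) + 1 = i then 1 else 0) / bigM n) =
      stateWeight w i / bigM n := by
    rw [stateWeight, Finset.sum_div]
    exact Finset.sum_congr rfl fun θ _ => (mul_div_assoc _ _ _).symm
  simp only [mul_sub, Finset.sum_sub_distrib, h7] at h2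
  simp only [mul_add, Finset.sum_add_distrib, mul_one] at h1
  simp only [mul_ite, mul_one, mul_zero, Finset.sum_ite_eq', Finset.mem_univ, if_true] at h1 h2
  linarith

/-- The principal cannot get anything in the state `θ_k` once all types `t_i` with `i ≤ k` are
excluded. -/
theorem weight_eq_zero_of_implements (hn : 0 < n)
    {m : Tree (Fin n) (Fin (n + 1)) (Fin n ⊕ Fin n)}
    {w : Fin n → ℝ} {S : Set (Fin (n + 1))} (hw : ∀ θ, 0 ≤ w θ)
    (hm : m.IsValid (chainPayoff n) w S)
    (h : m.Implements (chainPayoff n 0) (chainReward n) w S) {k : Fin n}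
    (hk : ∀ i ∈ S, (k : ℕ) + 1 < i) : w k = 0 := by
  have hM := two_le_bigM hn
  obtain ⟨σ, hσ, hopt, hpay⟩ := h
  have h1 := expectation_le (chainPayoff n) (chainReward n) (fun θ => 1 - if θ = k then 1 else 0)
    m w S σ hw hm hσ fun w hw t ht a ha => by
      -- Every admissible type loses `M` from `a'_k` in all states and nothing from `a_k`. So `a'_k`
      -- is optimal only if all weights vanish.
      by_cases hak : a = Sum.inr k
      · subst hak
        have h2 := ha (Sum.inl k)
        have h3 : ∀ θ, chainPayoff n t θ (Sum.inl k) = 0 := fun θ => by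
          simp only [chainPayoff]
          rw [if_pos (hk t ht).le, ite_self]
        have h4 : ∀ θ, chainPayoff n t θ (Sum.inr k) = -bigM n := fun θ => by
          simp only [chainPayoff]
          rw [if_pos (hk t ht), ite_self]
        simp only [h3, h4, mul_zero, Finset.sum_const_zero, ← Finset.sum_mul] at h2
        have h5 : ∑ θ, w θ = 0 :=
          le_antisymm (by nlinarith) (Finset.sum_nonneg fun θ _ => hw θ)
        have h6 := (Finset.sum_eq_zero_iff_of_nonneg fun θ _ => hw θ).1 h5
        simp [h6]
      · refine Finset.sum_le_sum fun θ _ => mul_le_mul_of_nonneg_left ?_ (hw θ)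
        unfold chainReward
        split_ifs <;> simp_all
  rw [hpay] at h1
  simp only [mul_sub, Finset.sum_sub_distrib, mul_ite, mul_one, mul_zero, Finset.sum_ite_eq',
    Finset.mem_univ, if_true] at h1
  exact le_antisymm (by linarith) (hw k)

/-- A leaf that gives the principal the largest conceivable payoff reveals the state. -/
theorem weight_eq_zero_of_implements_leaf {act : Fin (n + 1) → Fin n ⊕ Fin n → ℝ}
    {w : Fin n → ℝ} {S : Set (Fin (n + 1))} (hw : ∀ θ, 0 ≤ w θ)
    (hm : (leaf act : Tree (Fin n) (Fin (n + 1)) (Fin n ⊕ Fin n)).IsValid (chainPayoff n) w S)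
    (h : (leaf act : Tree (Fin n) (Fin (n + 1)) (Fin n ⊕ Fin n)).Implements (chainPayoff n 0)
      (chainReward n) w S) {j k : Fin n} (hjk : j ≠ k) :
    w j = 0 ∨ w k = 0 := by
  obtain ⟨σ, hσ, hopt, hpay⟩ := h
  by_contra! hne
  have hj : 0 < w j := lt_of_le_of_ne (hw j) (Ne.symm hne.1)
  have hk : 0 < w k := lt_of_le_of_ne (hw k) (Ne.symm hne.2)
  -- An action is rewarded in at most one state, so it misses the weight of `j` or that of `k`.
  have key : ∀ a, ∑ θ, w θ * chainReward n θ a ≤ (∑ θ, w θ) - min (w j) (w k) := by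
    intro a
    have h1 : ∀ l, a ≠ Sum.inr l → ∑ θ, w θ * chainReward n θ a ≤ (∑ θ, w θ) - w l := by
      intro l hl
      rw [← Finset.add_sum_erase _ _ (Finset.mem_univ l),
        ← Finset.add_sum_erase _ w (Finset.mem_univ l)]
      have : ∑ θ ∈ Finset.univ.erase l, w θ * chainReward n θ a ≤
          ∑ θ ∈ Finset.univ.erase l, w θ := Finset.sum_le_sum fun θ _ =>
        mul_le_of_le_one_right (hw θ) (chainReward_le_one θ a)
      have h0 : chainReward n l a = 0 := if_neg hl
      rw [h0]
      linarith
    by_cases ha : a = Sum.inr j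
    · have := h1 k fun h => hjk (Sum.inr_injective (ha.symm.trans h))
      linarith [min_le_right (w j) (w k)]
    · linarith [h1 j ha, min_le_left (w j) (w k)]
  have h2 : expectation (chainReward n) (leaf act) σ w ≤ (∑ θ, w θ) - min (w j) (w k) :=
    sum_mul_le_of_mem_stdSimplex hσ.1 fun t ht =>
      sum_mul_le_of_mem_stdSimplex (hm t (hσ.2 t ht)).1 fun a _ => key a
  linarith [lt_min hj hk]

/-! ### Growth of the deviation and the depth bound. -/

theorem deviation_nonneg (hn : 0 < n) (w : Fin n → ℝ) (i : ℕ) : 0 ≤ deviation hn w i :=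
  Finset.sum_nonneg fun _ _ => abs_nonneg _

theorem stateWeight_nonneg {w : Fin n → ℝ} (hw : ∀ θ, 0 ≤ w θ) (i : ℕ) : 0 ≤ stateWeight w i :=
  Finset.sum_nonneg fun θ _ => mul_nonneg (hw θ) (by split_ifs <;> norm_num)

theorem stateWeight_succ (w : Fin n → ℝ) (k : Fin n) : stateWeight w (k + 1) = w k := by
  simp [stateWeight, Fin.val_inj]

theorem deviation_eq (hn : 0 < n) (w : Fin n → ℝ) (k : Fin n) :
    deviation hn w k = |w k - w (lastState hn)| + deviation hn w (k + 1) := by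
  unfold deviation
  rw [← Finset.add_sum_erase _ _ (show k ∈ Finset.univ.filter fun θ : Fin n => (k : ℕ) ≤ θ by simp)]
  congr 2
  ext θ
  simp only [Finset.mem_erase, Finset.mem_filter, Finset.mem_univ, true_and, ne_eq, Fin.ext_iff]
  omega

theorem weight_last_le_deviation (hn : 0 < n) {w : Fin n → ℝ} {k : Fin n} (hk : w k = 0) :
    w (lastState hn) ≤ deviation hn w k := by
  rw [deviation_eq, hk, zero_sub, abs_neg]
  linarith [le_abs_self (w (lastState hn)), deviation_nonneg hn w (k + 1)]

theorem growth_bound {d : ℕ} (hd : d + 1 < n) : 2 * n * 2 ^ d / bigM n ≤ 1 / 2 := by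
  have hn : 0 < n := by omega
  have hM := two_le_bigM hn
  rw [div_le_iff₀ (by linarith)]
  have h2 : (2 : ℝ) ≤ n := by exact_mod_cast (by omega : 2 ≤ n)
  have h1 : (n : ℝ) * 2 ^ (d + 1) ≤ (n : ℝ) ^ (3 ^ n) := by
    calc (n : ℝ) * 2 ^ (d + 1) ≤ n * (n : ℝ) ^ (d + 1) := by gcongr
      _ = (n : ℝ) ^ (d + 2) := by ring
      -- There is ample room: `d + 2 ≤ n`, so exponent `n` in place of `3 ^ n` would do.
      _ ≤ (n : ℝ) ^ (3 ^ n) := by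
        refine pow_le_pow_right₀ (by linarith) ?_
        have := Nat.lt_pow_self (n := n) (by norm_num : 1 < 3)
        omega
  unfold bigM
  rw [pow_succ] at h1
  linarith

/-- The signals sent while `t_i` is the smallest admissible type hardly increase the deviation. -/
theorem sum_deviation_signal_le (hn : 0 < n) {k : ℕ} {π : Fin n → Fin k → ℝ}
    (hπ : ∀ θ, π θ ∈ stdSimplex ℝ (Fin k)) {w : Fin n → ℝ} (hw : ∀ θ, 0 ≤ w θ) (i : ℕ)
    (h : ∀ g (θ : Fin n), i ≤ θ → w θ * π θ g - w (lastState hn) * π (lastState hn) g ≤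
      stateWeight (fun θ => w θ * π θ g) i / bigM n) :
    ∑ g, deviation hn (fun θ => w θ * π θ g) i ≤
      deviation hn w i + 2 * n / bigM n * stateWeight w i := by
  have hM := two_le_bigM hn
  have hsum : ∀ θ, ∑ g, w θ * π θ g = w θ := fun θ => by
    rw [← Finset.mul_sum, (hπ θ).2, mul_one]
  have hst : ∑ g, stateWeight (fun θ => w θ * π θ g) i = stateWeight w i := sum_signal hπ w _
  have key : ∀ θ : Fin n, i ≤ θ →
      ∑ g, |w θ * π θ g - w (lastState hn) * π (lastState hn) g| ≤
        |w θ - w (lastState hn)| + 2 / bigM n * stateWeight w i := by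
    intro θ hθ
    -- If `x ≤ c` and `0 ≤ c`, then `|x| ≤ 2c - x`. The one-sided bounds thus control absolute
    -- values, because the sum of `x` over the signals is fixed.
    calc _ ≤ ∑ g, (2 / bigM n * stateWeight (fun θ => w θ * π θ g) i -
            (w θ * π θ g - w (lastState hn) * π (lastState hn) g)) := by
          refine Finset.sum_le_sum fun g _ => abs_le.2 ?_
          have h1 := h g θ hθ
          have h2 : 0 ≤ stateWeight (fun θ => w θ * π θ g) i / bigM n :=
            div_nonneg (stateWeight_nonneg (fun θ => mul_nonneg (hw θ) ((hπ θ).1 g)) i)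
              (by linarith)
          have h3 : 2 / bigM n * stateWeight (fun θ => w θ * π θ g) i =
            2 * (stateWeight (fun θ => w θ * π θ g) i / bigM n) := by ring
          constructor <;> linarith
      _ = 2 / bigM n * stateWeight w i - (w θ - w (lastState hn)) := by
          simp only [Finset.sum_sub_distrib, ← Finset.mul_sum, hst, hsum]
      _ ≤ _ := by linarith [neg_abs_le (w θ - w (lastState hn))]
  unfold deviation
  rw [Finset.sum_comm]
  calc _ ≤ ∑ θ ∈ Finset.univ.filter (fun θ : Fin n => i ≤ (θ : ℕ)),
        (|w θ - w (lastState hn)| + 2 / bigM n * stateWeight w i) :=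
        Finset.sum_le_sum fun θ hθ => key θ (Finset.mem_filter.1 hθ).2
    _ ≤ _ := by
      rw [Finset.sum_add_distrib, Finset.sum_const, nsmul_eq_mul]
      have hc : ((Finset.univ.filter fun θ : Fin n => i ≤ (θ : ℕ)).card : ℝ) ≤ n := by
        have := Finset.card_filter_le (Finset.univ : Finset (Fin n)) fun θ => i ≤ (θ : ℕ)
        rw [Finset.card_univ, Fintype.card_fin] at this
        exact_mod_cast this
      have h4 : 0 ≤ 2 / bigM n * stateWeight w i :=
        mul_nonneg (by positivity) (stateWeight_nonneg hw i)
      have := mul_le_mul_of_nonneg_right hc h4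
      have h5 : (n : ℝ) * (2 / bigM n * stateWeight w i) =
        2 * n / bigM n * stateWeight w i := by ring
      linarith

/-- A shallow tree can give the principal the largest conceivable payoff only if the weight of `θ_n` is
controlled by the differences between the weights. -/
theorem weight_last_le (hn : 0 < n) (m : Tree (Fin n) (Fin (n + 1)) (Fin n ⊕ Fin n))
    (w : Fin n → ℝ) (S : Set (Fin (n + 1))) (i : Fin (n + 1)) (d : ℕ) (hw : ∀ θ, 0 ≤ w θ)
    (hm : m.IsValid (chainPayoff n) w S)
    (h : m.Implements (chainPayoff n 0) (chainReward n) w S) (hi : i ∈ S)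
    (hmin : ∀ j ∈ S, i ≤ j) (hd : m.depth ≤ d) (hid : i + d + 1 < n) :
    w (lastState hn) ≤
      2 ^ d * deviation hn w i + 2 * n * 2 ^ d / bigM n * stateWeight w i := by
  have hM := two_le_bigM hn
  have coeff_nonneg : ∀ d : ℕ, 0 ≤ 2 * n * 2 ^ d / bigM n := fun d => by positivity
  induction m generalizing w S i d with
  | leaf act =>
    have h1 : w (lastState hn) ≤ deviation hn w i := by
      -- Since `i + 1 < n`, the states `θ_{i+1}` and `θ_n` differ, and a leaf leaves weight on only
      -- one of them.
      have hne : (⟨i, by omega⟩ : Fin n) ≠ lastState hn := by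
        simp only [lastState, ne_eq, Fin.ext_iff]
        omega
      rcases weight_eq_zero_of_implements_leaf hw hm h hne with h0 | h0
      · exact weight_last_le_deviation hn h0
      · rw [h0]
        exact deviation_nonneg hn w i
    have h2 : deviation hn w i ≤ 2 ^ d * deviation hn w i :=
      le_mul_of_one_le_left (deviation_nonneg hn w i) (one_le_pow₀ (by norm_num))
    have h3 := mul_nonneg (coeff_nonneg d) (stateWeight_nonneg hw i)
    linarith
  | signal k π child ih =>
    obtain ⟨e, rfl⟩ : ∃ e, d = e + 1 := Nat.exists_eq_add_one.2 (by rw [depth] at hd; omega)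
    have hwg : ∀ g θ, 0 ≤ w θ * π θ g := fun g θ => mul_nonneg (hw θ) ((hm.1 θ).1 g)
    have himp : ∀ g, _ := fun g => Implements.signal chainReward_le_one hw hm h g
    have hdg : ∀ g, (child g).depth ≤ e := fun g =>
      (Finset.le_sup (f := fun g => (child g).depth) (Finset.mem_univ g)).trans
        (by rw [depth] at hd; omega)
    have h1 := Finset.sum_le_sum fun g (_ : g ∈ Finset.univ) =>
      ih g (fun θ => w θ * π θ g) S i e (hwg g) (hm.2 g) (himp g) hi hmin (hdg g) (by omega)
    have h2 := sum_deviation_signal_le hn hm.1 hw i fun g θ hθ =>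
      weight_le_of_implements hn (hwg g) (hm.2 g) (himp g) hi hθ
    have h3 : ∑ g, w (lastState hn) * π (lastState hn) g = w (lastState hn) := by
      rw [← Finset.mul_sum, (hm.1 _).2, mul_one]
    have h4 : ∑ g, stateWeight (fun θ => w θ * π θ g) i = stateWeight w i := sum_signal hm.1 w _
    rw [h3, Finset.sum_add_distrib, ← Finset.mul_sum, ← Finset.mul_sum, h4] at h1
    have h5 := mul_le_mul_of_nonneg_left h2 (by positivity : (0 : ℝ) ≤ 2 ^ e)
    have h6 : (0 : ℝ) ≤ 2 ^ e * deviation hn w i :=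
      mul_nonneg (by positivity) (deviation_nonneg hn w i)
    -- The error of the children and the new deviation caused by the signals have equal
    -- coefficients, whence the factor 2 per level.
    calc _ ≤ _ := h1
      _ ≤ 2 ^ e * (deviation hn w i + 2 * n / bigM n * stateWeight w i) +
          2 * n * 2 ^ e / bigM n * stateWeight w i := by linarith
      _ = 2 ^ e * deviation hn w i + 2 * n * 2 ^ (e + 1) / bigM n * stateWeight w i := by ring
      _ ≤ _ := by rw [pow_succ (2 : ℝ) e]; linarith
  | elicit k opt child ih =>
    obtain ⟨e, rfl⟩ : ∃ e, d = e + 1 := Nat.exists_eq_add_one.2 (by rw [depth] at hd; omega)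
    obtain ⟨j, hj⟩ := Implements.elicit chainReward_le_one hw hm h
    have hdj : (child j).depth ≤ e :=
      (Finset.le_sup (f := fun g => (child g).depth) (Finset.mem_univ j)).trans
        (by rw [depth] at hd; omega)
    obtain ⟨i', hi', hmin'⟩ := Set.exists_min_image (opt j) id (Set.toFinite _) (hm.2.1 j)
    have hle : i ≤ i' := hmin i' (hm.1 ▸ Set.mem_iUnion_of_mem j hi')
    have hdev := deviation_nonneg hn w i
    have hst := stateWeight_nonneg hw i
    have hone : (1 : ℝ) ≤ 2 ^ e := one_le_pow₀ (by norm_num)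
    have hadd := mul_nonneg (coeff_nonneg e) hst
    have hdouble : 2 * n * 2 ^ (e + 1) / bigM n * stateWeight w i =
      2 * (2 * n * 2 ^ e / bigM n * stateWeight w i) := by ring
    rw [hdouble, pow_succ]
    have hprod := mul_le_mul_of_nonneg_right hone hdev
    rcases eq_or_lt_of_le hle with rfl | hlt
    · have := ih j w (opt j) i e hw (hm.2.2 j) hj hi' hmin' hdj (by omega)
      linarith
    set θ : Fin n := ⟨i, by omega⟩ with hθ
    have hθi : (θ : ℕ) = i := rfl
    -- If the smallest type advances by one, the error term involves the weight of `θ_{i+1}`, at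
    -- most its deviation plus the weight of `θ_n`. Its coefficient is at most `1/2`, so the weight
    -- of `θ_n` is absorbed on the left. If it advances further, `θ_{i+1}` has weight zero and the
    -- deviation already dominates.
    by_cases hsucc : (i' : ℕ) = i + 1
    · have h1 := ih j w (opt j) i' e hw (hm.2.2 j) hj hi' hmin' hdj (by omega)
      have h2 := deviation_eq hn w θ
      have h3 := stateWeight_succ w θ
      rw [hθi] at h2 h3
      rw [hsucc, h3] at h1
      have h4 := growth_bound (n := n) (d := e) (by omega)
      have h5 := mul_le_mul_of_nonneg_right h4 (hw θ)
      have h6 := le_abs_self (w θ - w (lastState hn))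
      have h7 := mul_nonneg (zero_le_one.trans hone) (deviation_nonneg hn w (i + 1))
      have h8 := mul_le_mul_of_nonneg_right hone (abs_nonneg (w θ - w (lastState hn)))
      have h9 := abs_nonneg (w θ - w (lastState hn))
      rw [h2]
      linarith
    · have h0 : w θ = 0 := weight_eq_zero_of_implements hn hw (hm.2.2 j) hj fun l hl => by
        have : i' ≤ l := hmin' l hl
        omega
      have := weight_last_le_deviation hn h0
      rw [hθi] at this
      linarith
  | ask k child ih =>
    obtain ⟨e, rfl⟩ : ∃ e, d = e + 1 := Nat.exists_eq_add_one.2 (by rw [depth] at hd; omega)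
    obtain ⟨j, hj⟩ := Implements.ask chainReward_le_one hw hm h
    have hdj : (child j).depth ≤ e + 1 :=
      (Finset.le_sup (f := fun g => (child g).depth) (Finset.mem_univ j)).trans
        (by rw [depth] at hd; omega)
    -- Non-binding questions change neither weights nor admissible types, so `d` need not decrease.
    exact ih j w S i (e + 1) hw (hm.2 j) hj hi hmin hdj hid

/-! ### The chain mechanism. -/

theorem isValid_pure_leaf {Θ T A : Type} [Fintype Θ] [Fintype A] [DecidableEq A]
    {u : T → Θ → A → ℝ} {w : Θ → ℝ} {S : Set T} {α : T → A}
    (h : ∀ t ∈ S, IsOptimalAction u w t (α t)) :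
    (leaf fun t => Pi.single (α t) 1 : Tree Θ T A).IsValid u w S := by
  refine fun t ht => ⟨single_mem_stdSimplex ℝ _, fun a ha => ?_⟩
  by_cases hat : a = α t
  · exact hat ▸ h t ht
  · exact absurd (Pi.single_eq_of_ne hat _) ha

theorem expectation_pure_leaf {Θ T A : Type} [Fintype Θ] [Fintype T] [Fintype A] [DecidableEq A]
    (f : Θ → A → ℝ) (α : T → A) (σ : T → ℝ) (w : Θ → ℝ) :
    expectation f (leaf fun t => Pi.single (α t) 1 : Tree Θ T A) σ w =
      ∑ t, σ t * ∑ θ, w θ * f θ (α t) := by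
  simp only [expectation, sum_single_mul]

theorem isFeasible_leaf_single {Θ T A : Type} [Fintype T] [DecidableEq T] (act : T → A → ℝ)
    {S : Set T} {t : T} (ht : t ∈ S) :
    (leaf act : Tree Θ T A).IsFeasible S (Pi.single t 1 : T → ℝ) := by
  refine ⟨single_mem_stdSimplex ℝ t, fun s hs => ?_⟩
  by_cases h : s = t
  · exact h ▸ ht
  · exact absurd (Pi.single_eq_of_ne h _) hs

theorem sum_pointMass_mul (k : Fin n) (c : ℝ) (x : Fin n → ℝ) :
    ∑ θ, (if θ = k then c else 0) * x θ = c * x k := by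
  simp

theorem isOptimalAction_pointMass {c : ℝ} (hc : 0 ≤ c) {t : Fin (n + 1)} {k : Fin n}
    {a : Fin n ⊕ Fin n} (h : ∀ b, chainPayoff n t k b ≤ chainPayoff n t k a) :
    IsOptimalAction (chainPayoff n) (fun θ => if θ = k then c else 0) t a := by
  intro b
  rw [sum_pointMass_mul, sum_pointMass_mul]
  exact mul_le_mul_of_nonneg_left (h b) hc

theorem chainPayoff_le_indicator (hn : 0 < n) (t : Fin (n + 1)) (θ : Fin n) (a : Fin n ⊕ Fin n) :
    chainPayoff n t θ a ≤ if θ = a.elim id id then 1 else 0 := by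
  have hM := two_le_bigM hn
  have h1 : 1 / bigM n ≤ 1 := by
    rw [div_le_one (by linarith)]
    linarith
  rcases a with j | j
  · change _ ≤ if θ = j then (1 : ℝ) else 0
    simp only [chainPayoff]
    split_ifs <;> norm_num
  · change _ ≤ if θ = j then (1 : ℝ) else 0
    simp only [chainPayoff]
    split_ifs <;> linarith

/-- A type `t_i` gets at most zero from actions other than `a'_i` if `θ_k` with `k ≤ i` is certain. -/
theorem chainPayoff_nonpos (hn : 0 < n) {t : Fin (n + 1)} {k : Fin n} (hk : (k : ℕ) + 1 ≤ t)
    {b : Fin n ⊕ Fin n} (hb : (k : ℕ) + 1 = t → b ≠ Sum.inr k) : chainPayoff n t k b ≤ 0 := by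
  have hM := two_le_bigM hn
  rcases b with j | j
  · by_cases h : k = j
    · subst h
      simp [chainPayoff, hk]
    · simp [chainPayoff, h]
  · by_cases h : k = j
    · subst h
      have h1 : (k : ℕ) + 1 < t := lt_of_le_of_ne hk fun h => hb h rfl
      simp only [chainPayoff, h1, if_true]
      linarith
    · simp only [chainPayoff, h, if_false]
      linarith

/-- The weights at the node of the chain mechanism where `θ_1, …, θ_i` have been ruled out. -/
noncomputable def chainWeight (n i : ℕ) (θ : Fin n) : ℝ := if i ≤ (θ : ℕ) then 1 / (n : ℝ) else 0

/-- A subtree that makes the agent, whose payoff is at most `1 / n`, play `a'_j` in each state `θ_j`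
with `j > i`. -/
def IsChainSubtree (i : ℕ) (m : Tree (Fin n) (Fin (n + 1)) (Fin n ⊕ Fin n)) : Prop :=
  m.IsValid (chainPayoff n) (chainWeight n i) {t | i ≤ (t : ℕ)} ∧
  (∀ σ : m.Strategy, m.IsFeasible {t | i ≤ (t : ℕ)} σ →
    m.expectation (chainPayoff n 0) σ (chainWeight n i) ≤ 1 / n) ∧
  ∃ σ : m.Strategy, m.IsFeasible {t | i ≤ (t : ℕ)} σ ∧
    m.expectation (chainPayoff n 0) σ (chainWeight n i) = 1 / n ∧
    m.expectation (chainReward n) σ (chainWeight n i) = ∑ θ, chainWeight n i θ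

theorem chainWeight_last (hn : 0 < n) :
    chainWeight n (n - 1) = fun θ => if θ = lastState hn then 1 / (n : ℝ) else 0 := by
  ext θ
  unfold chainWeight lastState
  congr 1
  simp only [Fin.ext_iff, eq_iff_iff]
  omega

/-- With `θ_n` certain, `a'_n` is optimal for both remaining types: it pays `t_{n-1}` the maximum 1,
and pays `t_n` only `1 / M`, but every other action pays `t_n` at most zero. -/
theorem exists_isChainSubtree_last (hn : 0 < n) :
    ∃ m : Tree (Fin n) (Fin (n + 1)) (Fin n ⊕ Fin n), IsChainSubtree (n - 1) m := by
  have hM := two_le_bigM hn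
  have hpos : (0 : ℝ) ≤ 1 / n := by positivity
  have hlast : ((lastState hn : Fin n) : ℕ) + 1 = n := Nat.sub_add_cancel hn
  have hM0 : 0 < 1 / bigM n := by positivity
  have hu0 : chainPayoff n 0 (lastState hn) (Sum.inr (lastState hn)) = 1 := by
    simp [chainPayoff, hlast, hn.ne']
  have hE : ∀ σ : Fin (n + 1) → ℝ, σ ∈ stdSimplex ℝ (Fin (n + 1)) →
      expectation (chainPayoff n 0) (leaf fun _ => Pi.single (Sum.inr (lastState hn)) 1) σ
        (chainWeight n (n - 1)) = 1 / n := fun σ hσ => by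
    rw [chainWeight_last hn, expectation_pure_leaf]
    simp only [sum_pointMass_mul, hu0, ← Finset.sum_mul, hσ.2]
    ring
  refine ⟨leaf fun _ => Pi.single (Sum.inr (lastState hn)) 1, ?_, fun σ hσ => (hE σ hσ.1).le,
    (Pi.single (Fin.last n) 1 : Fin (n + 1) → ℝ), isFeasible_leaf_single _ (by simp),
    hE _ (single_mem_stdSimplex ℝ _), ?_⟩
  · rw [chainWeight_last hn]
    refine isValid_pure_leaf fun t ht => isOptimalAction_pointMass hpos fun b => ?_
    rcases Nat.lt_or_ge t n with h | h
    · have h1 : chainPayoff n t (lastState hn) (Sum.inr (lastState hn)) = 1 := by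
        simp [chainPayoff, hlast, h.ne', h.not_gt]
      rw [h1]
      refine (chainPayoff_le_indicator hn _ _ _).trans ?_
      split_ifs <;> norm_num
    · have htn : (t : ℕ) = n := by omega
      by_cases hb : b = Sum.inr (lastState hn)
      · rw [hb]
      · refine (chainPayoff_nonpos hn (by omega) fun _ => hb).trans ?_
        simp only [chainPayoff, hlast, htn]
        simp only [if_true, lt_irrefl, if_false]
        exact hM0.le
  · rw [chainWeight_last hn, expectation_pure_leaf, sum_single_mul, sum_pointMass_mul]
    simp [chainReward]

/-- The agent either claims to be `t_i`, so that `a_{i+1}` is played at once, or excludes `t_i` and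
is told whether the state is `θ_{i+1}`. The second option pays `t_0` zero in `θ_{i+1}` and at most
`1 / n` afterwards, so it can tie with the first but not beat it. -/
theorem exists_isChainSubtree_of_succ (hn : 0 < n) {i : ℕ} (hi : i + 1 < n)
    {m : Tree (Fin n) (Fin (n + 1)) (Fin n ⊕ Fin n)} (hm : IsChainSubtree (i + 1) m) :
    ∃ m' : Tree (Fin n) (Fin (n + 1)) (Fin n ⊕ Fin n), IsChainSubtree i m' := by
  classical
  have hM := two_le_bigM hn
  have hM0 : 0 < 1 / bigM n := by positivity
  have hpos : (0 : ℝ) ≤ 1 / n := by positivity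
  obtain ⟨hvalid, hle, σ₁, hσ₁, hu₁, hv₁⟩ := hm
  set k : Fin n := ⟨i, by omega⟩ with hk
  set k' : Fin n := ⟨i + 1, hi⟩ with hk'
  set t₀ : Fin (n + 1) := ⟨i, by omega⟩ with ht₀
  set t₁ : Fin (n + 1) := ⟨i + 1, by omega⟩ with ht₁
  let insist : Tree (Fin n) (Fin (n + 1)) (Fin n ⊕ Fin n) := leaf fun _ => Pi.single (Sum.inl k) 1
  -- When `θ_{i+1}` is revealed, `t_{i+1}` strictly prefers `a'_{i+1}`. Larger types cannot get a
  -- positive payoff, so the harmless `a_{i+2}` is optimal for them.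
  let α : Fin (n + 1) → Fin n ⊕ Fin n := fun t => if t = t₁ then Sum.inr k else Sum.inl k'
  let reveal : Tree (Fin n) (Fin (n + 1)) (Fin n ⊕ Fin n) := leaf fun t => Pi.single (α t) 1
  let π : Fin n → Fin 2 → ℝ := fun θ => if θ = k then Pi.single 0 1 else Pi.single 1 1
  have hw0 : (fun θ => chainWeight n i θ * π θ 0) = fun θ => if θ = k then 1 / (n : ℝ) else 0 := by
    ext θ
    by_cases h : θ = k
    · simp [π, h, chainWeight, hk]
    · simp [π, h]
  have hw1 : (fun θ => chainWeight n i θ * π θ 1) = chainWeight n (i + 1) := by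
    ext θ
    by_cases h : θ = k
    · simp [π, h, chainWeight, hk]
    · have : (θ : ℕ) ≠ i := fun h' => h (Fin.ext h')
      simp only [π, h, if_false, Pi.single_eq_same, mul_one, chainWeight]
      congr 1
      simp only [eq_iff_iff]
      omega
  have hπ : ∀ θ, π θ ∈ stdSimplex ℝ (Fin 2) := fun θ => by
    simp only [π]
    split_ifs <;> exact single_mem_stdSimplex ℝ _
  have hinsist : ∀ σ : Fin (n + 1) → ℝ, σ ∈ stdSimplex ℝ (Fin (n + 1)) →
      insist.expectation (chainPayoff n 0) σ (chainWeight n i) = 1 / n := fun σ hσ => by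
    rw [expectation_pure_leaf, ← Finset.sum_mul, hσ.2]
    simp [chainPayoff, chainWeight, hk]
  have hreveal : ∀ σ : Fin (n + 1) → ℝ, reveal.expectation (chainPayoff n 0) σ
      (fun θ => if θ = k then 1 / (n : ℝ) else 0) = 0 := fun σ => by
    rw [expectation_pure_leaf]
    refine Finset.sum_eq_zero fun t _ => ?_
    rw [sum_pointMass_mul]
    have h0 : chainPayoff n 0 k (α t) = 0 := by
      have h1 : k ≠ k' := by simp [hk, hk']
      have h2 : (k : ℕ) + 1 ≠ n := hi.ne
      simp only [α]
      split_ifs <;> simp [chainPayoff, h1, h2]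
    rw [h0, mul_zero, mul_zero]
  let reveals : Tree (Fin n) (Fin (n + 1)) (Fin n ⊕ Fin n) := signal 2 π ![reveal, m]
  have hsplit : ∀ (f : Fin n → Fin n ⊕ Fin n → ℝ) (σ : reveals.Strategy),
      reveals.expectation f σ (chainWeight n i) =
        reveal.expectation f (σ 0) (fun θ => if θ = k then 1 / (n : ℝ) else 0) +
        m.expectation f (σ 1) (chainWeight n (i + 1)) := fun f σ => by
    rw [← hw0, ← hw1]
    exact Fin.sum_univ_two _
  have hreveals_le : ∀ ρ : reveals.Strategy, m.IsFeasible {t | i + 1 ≤ (t : ℕ)} (ρ 1) →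
      reveals.expectation (chainPayoff n 0) ρ (chainWeight n i) ≤ 1 / n := fun ρ hρ =>
    (hsplit _ ρ).trans_le
      ((add_le_add (hreveal (ρ 0)).le (hle _ hρ)).trans_eq (zero_add _))
  let opt : Fin 2 → Set (Fin (n + 1)) := ![{t₀}, {t | i + 1 ≤ (t : ℕ)}]
  let tree : Tree (Fin n) (Fin (n + 1)) (Fin n ⊕ Fin n) := elicit 2 opt ![insist, reveals]
  have helicit : ∀ (f : Fin n → Fin n ⊕ Fin n → ℝ) (σ : tree.Strategy),
      tree.expectation f σ (chainWeight n i) =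
        σ.1 0 * insist.expectation f (σ.2 0) (chainWeight n i) +
        σ.1 1 * reveals.expectation f (σ.2 1) (chainWeight n i) := fun f σ =>
    Fin.sum_univ_two _
  have hreveals_valid :
      reveals.IsValid (chainPayoff n) (chainWeight n i) {t | i + 1 ≤ (t : ℕ)} := by
    refine ⟨hπ, Fin.forall_fin_two.2 ⟨?_, ?_⟩⟩
    · rw [hw0]
      refine isValid_pure_leaf fun t (ht : i + 1 ≤ (t : ℕ)) =>
        isOptimalAction_pointMass hpos fun b => ?_
      by_cases h : t = t₁
      · have htk : (k : ℕ) + 1 = t := by rw [h]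
        have hα : α t = Sum.inr k := if_pos h
        rw [hα]
        by_cases hb : b = Sum.inr k
        · rw [hb]
        · refine (chainPayoff_nonpos hn htk.le fun _ => hb).trans ?_
          simp only [chainPayoff, htk]
          simp only [if_true, lt_irrefl, if_false]
          exact hM0.le
      · have htk : (k : ℕ) + 1 ≠ t := fun h' => h (Fin.ext h'.symm)
        have hα : α t = Sum.inl k' := if_neg h
        have h1 : k ≠ k' := by simp [hk, hk']
        have h0 : chainPayoff n t k (Sum.inl k') = 0 := by simp [chainPayoff, h1]
        rw [hα, h0]
        exact chainPayoff_nonpos hn ht fun h' => absurd h' htk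
    · rw [hw1]
      exact hvalid
  have hinsist_valid : insist.IsValid (chainPayoff n) (chainWeight n i) {t₀} := by
    refine isValid_pure_leaf fun t ht b => ?_
    rw [Set.mem_singleton_iff.1 ht]
    have h1 : ∑ θ, chainWeight n i θ * chainPayoff n t₀ θ (Sum.inl k) = 1 / n := by
      simp [chainPayoff, chainWeight, hk, ht₀]
    rw [h1]
    have hnonneg : ∀ θ, 0 ≤ chainWeight n i θ := fun θ => by
      unfold chainWeight
      split_ifs <;> positivity
    -- No action pays `t_i` more than 1, or a positive amount outside its own state, and all
    -- remaining states have weight `1 / n`.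
    refine (Finset.sum_le_sum fun θ _ => mul_le_mul_of_nonneg_left
      (chainPayoff_le_indicator hn t₀ θ b) (hnonneg θ)).trans ?_
    simp only [mul_ite, mul_one, mul_zero, Finset.sum_ite_eq', Finset.mem_univ, if_true]
    unfold chainWeight
    split_ifs
    · exact le_rfl
    · exact hpos
  refine ⟨tree, ⟨?_, Fin.forall_fin_two.2 ⟨⟨t₀, rfl⟩, ⟨t₁, le_refl (i + 1)⟩⟩,
    Fin.forall_fin_two.2 ⟨hinsist_valid, hreveals_valid⟩⟩, fun σ hσ => ?_, ?_⟩
  · ext t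
    simp only [Set.mem_iUnion, Fin.exists_fin_two, opt, Matrix.cons_val_zero, Matrix.cons_val_one,
      Set.mem_singleton_iff, Set.mem_ofPred_eq, ht₀, Fin.ext_iff]
    omega
  · have h2 : reveals.expectation (chainPayoff n 0) (σ.2 1) (chainWeight n i) ≤ 1 / n :=
      hreveals_le _ (hσ.2 1 1)
    have h3 : σ.1 0 + σ.1 1 = 1 := by
      rw [← Fin.sum_univ_two]
      exact hσ.1.2
    rw [helicit, hinsist _ (hσ.2 0).1]
    calc _ ≤ σ.1 0 * (1 / (n : ℝ)) + σ.1 1 * (1 / n) := by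
          gcongr
          exact hσ.1.1 1
      _ = 1 / n := by rw [← add_mul, h3, one_mul]
  -- The principal's preferred best response: exclude `t_i`, imitate `t_{i+1}` if `θ_{i+1}` is
  -- revealed, and otherwise follow `σ₁`.
  · let ρ : reveals.Strategy :=
      Fin.cons (α := fun g => (![reveal, m] g).Strategy) (Pi.single t₁ 1 : Fin (n + 1) → ℝ)
        (Fin.cons (α := fun g : Fin 1 => (![reveal, m] g.succ).Strategy) σ₁ finZeroElim)
    let τ : tree.Strategy := ((Pi.single 1 1 : Fin 2 → ℝ),
      Fin.cons (α := fun j => (![insist, reveals] j).Strategy) (Pi.single t₀ 1 : Fin (n + 1) → ℝ)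
        (Fin.cons (α := fun j : Fin 1 => (![insist, reveals] j.succ).Strategy) ρ finZeroElim))
    have hτ : ∀ f, tree.expectation f τ (chainWeight n i) =
        reveal.expectation f (Pi.single t₁ 1 : Fin (n + 1) → ℝ)
          (fun θ => if θ = k then 1 / (n : ℝ) else 0) +
        m.expectation f σ₁ (chainWeight n (i + 1)) := fun f => by
      have hone : ∀ x y : ℝ,
          (Pi.single 1 1 : Fin 2 → ℝ) 0 * x + (Pi.single 1 1 : Fin 2 → ℝ) 1 * y = y := by simp
      exact (helicit f τ).trans ((hone _ _).trans (hsplit f ρ))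
    refine ⟨τ, ⟨single_mem_stdSimplex ℝ _, Fin.forall_fin_two.2 ⟨?_, Fin.forall_fin_two.2 ⟨?_, ?_⟩⟩⟩,
      ?_, ?_⟩
    · exact isFeasible_leaf_single _ rfl
    · exact isFeasible_leaf_single _ (show t₁ ∈ {t : Fin (n + 1) | i + 1 ≤ (t : ℕ)} from le_refl (i + 1))
    · exact hσ₁
    · rw [hτ, hreveal, hu₁, zero_add]
    · rw [hτ, hv₁, expectation_pure_leaf, sum_single_mul, sum_pointMass_mul]
      have h0 : chainReward n k (α t₁) = 1 := by simp [chainReward, α]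
      have h1 : ∑ θ, chainWeight n i θ = ∑ θ : Fin n, (if θ = k then 1 / (n : ℝ) else 0) +
          ∑ θ, chainWeight n (i + 1) θ := by
        rw [← hw0, ← hw1, ← Finset.sum_add_distrib]
        refine Finset.sum_congr rfl fun θ _ => ?_
        rw [← mul_add, ← Fin.sum_univ_two (π θ), (hπ θ).2, mul_one]
      rw [h0, h1]
      simp

theorem exists_isChainSubtree (hn : 0 < n) (j i : ℕ) (hij : i + j + 1 = n) :
    ∃ m : Tree (Fin n) (Fin (n + 1)) (Fin n ⊕ Fin n), IsChainSubtree i m := by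
  induction j generalizing i with
  | zero =>
    obtain rfl : i = n - 1 := by omega
    exact exists_isChainSubtree_last hn
  | succ j ih =>
    obtain ⟨m, hm⟩ := ih (i + 1) (by omega)
    exact exists_isChainSubtree_of_succ hn (by omega) hm

/-! ### Optimal value and depth of optimal mechanisms. -/

theorem sum_prior (hn : 0 < n) : ∑ θ, (chainInstance n hn).prior θ = 1 :=
  (chainInstance n hn).prior_mem.2

theorem payoff_chainInstance (hn : 0 < n) (P : PIEMechanism (chainInstance n hn)) :
    P.payoff = P.tree.expectation (chainReward n) (P.response 0) (chainInstance n hn).prior :=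
  sum_single_mul (0 : Fin (n + 1)) _

theorem payoff_le_one (hn : 0 < n) (P : PIEMechanism (chainInstance n hn)) : P.payoff ≤ 1 := by
  rw [payoff_chainInstance, ← sum_prior hn]
  exact expectation_le_sum _ _ chainReward_le_one _ _ _ _ (chainInstance n hn).prior_mem.1 P.valid
    (P.isBestResponse 0).1

theorem exists_payoff_eq_one (hn : 0 < n) :
    ∃ P : PIEMechanism (chainInstance n hn), P.payoff = 1 := by
  classical
  obtain ⟨m, hvalid, hle, σ, hσ, hu, hv⟩ := exists_isChainSubtree hn (n - 1) 0 (by omega)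
  have hprior : chainWeight n 0 = (chainInstance n hn).prior := by
    ext θ
    simp [chainWeight, chainInstance]
  have huniv : {t : Fin (n + 1) | 0 ≤ (t : ℕ)} = Set.univ := by
    ext t
    simp
  rw [hprior, huniv] at hvalid
  rw [hprior, sum_prior hn] at hv
  rw [huniv] at hle hσ
  rw [hprior] at hle hu
  choose τ hτ using fun t => exists_isMaximal (chainPayoff n) (chainPayoff n t) m
    (chainInstance n hn).prior Set.univ Set.univ_nonempty hvalid
  refine ⟨⟨m, hvalid, Function.update τ 0 σ, fun t => ?_⟩, ?_⟩
  · by_cases h : t = 0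
    · subst h
      rw [Function.update_self]
      exact ⟨hσ, fun σ' hσ' => (hle σ' hσ').trans hu.ge⟩
    · rw [Function.update_of_ne h]
      exact hτ t
  · rw [payoff_chainInstance]
    simp only [Function.update_self]
    exact hv

theorem le_depth_add_one_of_payoff_eq_one (hn : 0 < n) (P : PIEMechanism (chainInstance n hn))
    (hP : P.payoff = 1) : n ≤ P.depth + 1 := by
  by_contra! hlt
  have himp : P.tree.Implements (chainPayoff n 0) (chainReward n) (chainInstance n hn).prior
      Set.univ :=
    ⟨P.response 0, (P.isBestResponse 0).1, (P.isBestResponse 0).2, by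
      rw [← payoff_chainInstance, hP, sum_prior]⟩
  have h := weight_last_le hn P.tree (chainInstance n hn).prior Set.univ 0 P.depth
    (chainInstance n hn).prior_mem.1 P.valid himp (Set.mem_univ _) (fun j _ => Fin.zero_le j) le_rfl
    (by simpa using hlt)
  -- At the root both terms of the bound vanish: the prior is uniform, and there is no state `θ_0`.
  have h1 : deviation hn (chainInstance n hn).prior 0 = 0 := by
    simp [deviation, chainInstance]
  have h2 : stateWeight (chainInstance n hn).prior 0 = 0 := by
    simp [stateWeight]
  have h3 : 0 < (chainInstance n hn).prior (lastState hn) := by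
    simp [chainInstance, hn]
  rw [Fin.val_zero, h1, h2] at h
  linarith

end Chain

end Persuasion

theorem mainTheorem4 :
    ∃ c : ℝ, 0 < c ∧ ∃ N : ℕ, ∀ (n : ℕ) (hn : 0 < n), N ≤ n →
      (∃ P : Persuasion.PIEMechanism (Persuasion.chainInstance n hn), P.IsOptimal) ∧
      ∀ P : Persuasion.PIEMechanism (Persuasion.chainInstance n hn),
        P.IsOptimal → c * (n : ℝ) ≤ (P.depth : ℝ) := by
  -- The depth is at least `n - 1`, which is at least `n / 2` once `n ≥ 2`.
  refine ⟨1 / 2, by norm_num, 2, fun n hn hN => ?_⟩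
  obtain ⟨P₀, hP₀⟩ := Persuasion.exists_payoff_eq_one hn
  refine ⟨⟨P₀, fun P' => hP₀ ▸ Persuasion.payoff_le_one hn P'⟩, fun P hP => ?_⟩
  have h1 : P.payoff = 1 := le_antisymm (Persuasion.payoff_le_one hn P) (hP₀ ▸ hP P₀)
  have h2 := Persuasion.le_depth_add_one_of_payoff_eq_one hn P h1
  have h3 : (n : ℝ) ≤ P.depth + 1 := by exact_mod_cast h2
  have h4 : (2 : ℝ) ≤ n := by exact_mod_cast hN
  linarith
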